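/- Let $n\ge 1$ and let $\mathcal S_n=\{A\in\mathbb C^{n\times n}: A^T=A\}$ be the real vector space of complex symmetric $n\times n$ matrices, which has real dimension $n^2+n$. For $A\in\mathcal S_n$ let $\sigma_1(A)\ge\dots\ge\sigma_n(A)\ge 0$ be its singular values. Say that a subset $W$ of a finite-dimensional real vector space $E$ has real codimension $k$ if $W$ is a disjoint union of finitely many nonempty embedded $C^\infty$ submanifolds of $E$ (its strata), the largest of whose dimensions is $\dim_{\mathbb R}E-k$. Then: (i) if $n\ge 2$, the set of $A\in\mathcal S_n$ with two equal singular values, i.e. $\sigma_i(A)=\sigma_j(A)$ for some $i\ne j$, has real codimension $2$ in $\mathcal S_n$; (ii) the set of $A\in\mathcal S_n$ with a zero singular value, i.e. $\sigma_n(A)=0$, has real codimension $2$ in $\mathcal S_n$. -/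

import Mathlib

open scoped ContDiff

-- All norms on the finite-dimensional space of matrices induce the same smooth structure;
-- the entrywise sup norm is fixed here.
attribute [local instance] Matrix.normedAddCommGroup Matrix.normedSpace

/-- The real vector space of complex symmetric `n × n` matrices (`Aᵀ = A`, no conjugation). -/
def symmMatrices (n : ℕ) : Submodule ℝ (Matrix (Fin n) (Fin n) ℂ) where
  carrier := {A | A.IsSymm}
  add_mem' hA hB := Matrix.IsSymm.add hA hB
  zero_mem' := Matrix.isSymm_zero
  smul_mem' c _ hA := Matrix.IsSymm.smul hA c

/-- The `i`-th singular value (in decreasing order, with multiplicity) of a square complex matrix,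
acting on `ℂⁿ` with its standard Hermitian inner product. -/
noncomputable def matrixSingularValue {n : ℕ} (A : Matrix (Fin n) (Fin n) ℂ) (i : Fin n) : ℝ :=
  (Matrix.toEuclideanLin A).singularValues i

/-- Complex symmetric matrices with two equal singular values (possibly both zero). -/
def equalSingularValueSet (n : ℕ) : Set (symmMatrices n) :=
  {A | ∃ i j : Fin n, i ≠ j ∧
    matrixSingularValue (A : Matrix (Fin n) (Fin n) ℂ) i =
      matrixSingularValue (A : Matrix (Fin n) (Fin n) ℂ) j}

/-- Complex symmetric matrices with a zero singular value. -/
def zeroSingularValueSet (n : ℕ) : Set (symmMatrices n) :=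
  {A | ∃ i : Fin n, matrixSingularValue (A : Matrix (Fin n) (Fin n) ℂ) i = 0}

section Codimension

variable {E : Type*} [NormedAddCommGroup E] [NormedSpace ℝ E]

/-- `M` is an embedded `C^∞` submanifold of `E` of dimension `d`: around each of its points some
smooth diffeomorphism between open subsets of `E` straightens `M` to a `d`-dimensional linear
subspace (slice charts). -/
def IsSmoothSubmanifold (M : Set E) (d : ℕ) : Prop :=
  ∀ x ∈ M, ∃ (φ : OpenPartialHomeomorph E E) (L : Submodule ℝ E),
    x ∈ φ.source ∧ ContDiffOn ℝ ∞ φ φ.source ∧ ContDiffOn ℝ ∞ φ.symm φ.target ∧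
      Module.finrank ℝ L = d ∧ ∀ y ∈ φ.source, y ∈ M ↔ φ y ∈ L

/-- `W` is a disjoint union of finitely many nonempty embedded smooth submanifolds (the strata),
and the maximum of the dimensions of the strata is `d`. -/
def HasStratifiedDim (W : Set E) (d : ℕ) : Prop :=
  ∃ (m : ℕ) (M : Fin m → Set E) (δ : Fin m → ℕ),
    (∀ i, (M i).Nonempty ∧ IsSmoothSubmanifold (M i) (δ i)) ∧
    (∀ i j, i ≠ j → Disjoint (M i) (M j)) ∧
    (⋃ i, M i) = W ∧
    (∀ i, δ i ≤ d) ∧ ∃ i, δ i = d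

/-- `W` has real codimension `k` in `E`: the maximum dimension of the strata of `W` is
`dim E - k`. -/
def HasRealCodim (W : Set E) (k : ℕ) : Prop :=
  ∃ d : ℕ, d + k = Module.finrank ℝ E ∧ HasStratifiedDim W d

end Codimension

/-!
The strata are the sets of symmetric matrices whose decreasing vector of singular values has a
prescribed *coincidence pattern*: which entries are equal to each other, and which are zero. There
are finitely many patterns, they partition the space, and both sets of the theorem are unions of
strata. What has to be shown is that each stratum is a submanifold of a dimension that can be read
off from its pattern.

The unitary group acts on symmetric matrices by `A ↦ Vᵀ A V`, preserving singular values, and by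
Takagi's factorization every `A` lies in the orbit of `diag σ`, where `σ` is its vector of singular
values (`Matrix.IsSymm.exists_takagi`, `matrixSingularValue_of_takagi`). Near such a point there is
a slice for this action. Every symmetric `X` splits uniquely as `Sᵀ diag σ + D + diag σ S`, where `S`
is skew-Hermitian and complementary to the stabilizer of `diag σ`, and `D` is block diagonal with
respect to the classes of equal `σ i`, real on the blocks with `σ i ≠ 0`
(`skewPart_add_slicePart`). So `X ↦ Wᵀ (exp S)ᵀ (diag σ + D) (exp S) W` has the invertible derivative
`X ↦ Wᵀ X W` at `0`, and by the inverse function theorem it parametrizes a neighbourhood of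
`Wᵀ diag σ W`.

Since `Wᵀ (exp S)ᵀ … (exp S) W` is a unitary congruence, its singular values are those of
`diag σ + D`. The key point, `block_rigidity`, is that for small `D` this block diagonal matrix has
the same pattern as `σ` only if `D` is a real scalar on each block and zero on the block of `σ i = 0`:
the blocks have singular values near distinct numbers, so a block with two different singular values
would increase the number of distinct ones. These conditions on `D` are linear in `X` and define
`patternSpace`, whose dimension is therefore the dimension of the stratum. A coincidence
`σ a = σ b` imposes the two real equations `Re X a b = 0` and `Re X a a = Re X b b`, and a zero
`σ a = 0` the complex equation `X a a = 0`, so the dimension is at most `n² + n - 2`; equality holds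
for the pattern with this coincidence, or this zero, only.
-/

/-! ### Takagi factorization and singular values -/

section Takagi

variable {V : Type*} [NormedAddCommGroup V] [InnerProductSpace ℂ V]

/-- A symmetric antilinear operator has a unit vector `x` with `T x = s • x`, `s ≥ 0`, in every nonzero
invariant subspace. Its square is linear with an eigenvalue `s ^ 2`, and if `x` is an eigenvector of
the square, then `T x + s • x` is such a vector unless it vanishes, in which case `i • x` is one. -/
theorem exists_unit_coneigenvector [FiniteDimensional ℂ V] (T : V →ₛₗ[starRingEnd ℂ] V)
    (hT : ∀ x y, inner ℂ x (T y) = inner ℂ y (T x)) (W : Submodule ℂ V) (hW : W ≠ ⊥)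
    (hTW : ∀ x ∈ W, T x ∈ W) :
    ∃ x ∈ W, ‖x‖ = 1 ∧ ∃ s : ℝ, 0 ≤ s ∧ T x = (s : ℂ) • x := by
  -- normalizing by a real scalar commutes with the antilinear `T`
  suffices h : ∃ y ∈ W, y ≠ 0 ∧ ∃ s : ℝ, 0 ≤ s ∧ T y = (s : ℂ) • y by
    obtain ⟨y, hy, hy0, s, hs, hTy⟩ := h
    refine ⟨((‖y‖⁻¹ : ℝ) : ℂ) • y, W.smul_mem _ hy, ?_, s, hs, ?_⟩
    · rw [norm_smul, Complex.norm_real, norm_inv, norm_norm, inv_mul_cancel₀ (norm_ne_zero_iff.2 hy0)]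
    · rw [T.map_smulₛₗ, hTy, Complex.conj_ofReal, smul_comm]
  have : Nontrivial W := Submodule.nontrivial_iff_ne_bot.2 hW
  let T2 : W →ₗ[ℂ] W :=
    { toFun := fun x => ⟨T (T x), hTW _ (hTW _ x.2)⟩
      map_add' := fun x y => by ext; simp
      map_smul' := fun c x => by ext; simp [T.map_smulₛₗ] }
  obtain ⟨μ, hμ⟩ := Module.End.exists_eigenvalue T2
  obtain ⟨x, hx⟩ := hμ.exists_hasEigenvector
  have hx0 : (x : V) ≠ 0 := by simpa using hx.2
  have hTT : T (T (x : V)) = μ • (x : V) := congrArg Subtype.val hx.apply_eq_smul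
  have hnx : ‖(x : V)‖ ≠ 0 := norm_ne_zero_iff.2 hx0
  set s : ℝ := ‖T (x : V)‖ / ‖(x : V)‖ with hs
  have hs0 : 0 ≤ s := by positivity
  have hμs : μ = (s : ℂ) * s := by
    have h := hT (x : V) (T x)
    -- `μ ‖x‖² = ⟪x, T (T x)⟫ = ⟪T x, T x⟫`
    rw [hTT, inner_smul_right, inner_self_eq_norm_sq_to_K, inner_self_eq_norm_sq_to_K] at h
    have : (‖(x : V)‖ : ℂ) ≠ 0 := by exact_mod_cast hnx
    rw [hs]; push_cast
    field_simp
    simpa using h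
  by_cases hy : T (x : V) + (s : ℂ) • (x : V) = 0
  · refine ⟨Complex.I • (x : V), W.smul_mem _ x.2, smul_ne_zero Complex.I_ne_zero hx0, s, hs0, ?_⟩
    rw [T.map_smulₛₗ, eq_neg_of_add_eq_zero_left hy, Complex.conj_I, smul_neg, neg_smul, neg_neg,
      smul_comm]
  · refine ⟨_, W.add_mem (hTW _ x.2) (W.smul_mem (s : ℂ) x.2), hy, s, hs0, ?_⟩
    rw [map_add, T.map_smulₛₗ, hTT, Complex.conj_ofReal, hμs, smul_add, smul_smul, add_comm]

theorem exists_orthonormal_coneigenvectors [FiniteDimensional ℂ V] (T : V →ₛₗ[starRingEnd ℂ] V)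
    (hT : ∀ x y, inner ℂ x (T y) = inner ℂ y (T x)) (k : ℕ) (hk : k ≤ Module.finrank ℂ V) :
    ∃ (v : Fin k → V) (s : Fin k → ℝ), Orthonormal ℂ v ∧
      ∀ i, 0 ≤ s i ∧ T (v i) = (s i : ℂ) • v i := by
  induction k with
  | zero => exact ⟨Fin.elim0, Fin.elim0, ⟨fun i => i.elim0, fun i => i.elim0⟩, fun i => i.elim0⟩
  | succ k ih =>
    obtain ⟨v, s, hv, hs⟩ := ih (by omega)
    have hW : (Submodule.span ℂ (Set.range v))ᗮ ≠ ⊥ := by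
      intro h
      rw [Submodule.orthogonal_eq_bot_iff] at h
      have := finrank_range_le_card (R := ℂ) v
      rw [Set.finrank, h, finrank_top, Fintype.card_fin] at this
      omega
    have mem_iff : ∀ x, x ∈ (Submodule.span ℂ (Set.range v))ᗮ ↔ ∀ i, inner ℂ (v i) x = 0 := by
      intro x
      constructor
      · exact fun h i => h _ (Submodule.subset_span ⟨i, rfl⟩)
      · intro h
        have : Submodule.span ℂ (Set.range v) ≤ (ℂ ∙ x)ᗮ := by
          rw [Submodule.span_le]
          rintro _ ⟨i, rfl⟩
          rw [SetLike.mem_coe, Submodule.mem_orthogonal_singleton_iff_inner_left]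
          exact h i
        intro y hy
        exact Submodule.mem_orthogonal_singleton_iff_inner_left.1 (this hy)
    obtain ⟨x, hx, hx1, t, ht, hTx⟩ := exists_unit_coneigenvector T hT _ hW (by
      intro x hx
      rw [mem_iff] at hx ⊢
      intro i
      rw [hT, (hs i).2, inner_smul_right, ← inner_conj_symm, hx i]
      simp)
    rw [mem_iff] at hx
    refine ⟨Fin.snoc v x, Fin.snoc s t, ⟨?_, ?_⟩, ?_⟩
    · intro i
      induction i using Fin.lastCases with
      | last => simpa using hx1
      | cast i => simpa using hv.1 i
    · intro i j hij
      induction i using Fin.lastCases with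
      | last =>
        induction j using Fin.lastCases with
        | last => exact absurd rfl hij
        | cast j =>
          simp only [Fin.snoc_last, Fin.snoc_castSucc]
          rw [← inner_conj_symm, hx j, map_zero]
      | cast i =>
        induction j using Fin.lastCases with
        | last => simpa using hx i
        | cast j =>
          simp only [Fin.snoc_castSucc]
          exact hv.2 (fun h => hij (by rw [h]))
    · intro i
      induction i using Fin.lastCases with
      | last => simpa using ⟨ht, hTx⟩
      | cast i => simpa using hs i

end Takagi

open Matrix in
/-- **Takagi factorization** of a complex symmetric matrix, with decreasing diagonal. -/
theorem Matrix.IsSymm.exists_takagi {n : ℕ} {A : Matrix (Fin n) (Fin n) ℂ} (hA : A.IsSymm) :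
    ∃ W ∈ unitaryGroup (Fin n) ℂ, ∃ σ : Fin n → ℝ, Antitone σ ∧ (∀ i, 0 ≤ σ i) ∧
      A = Wᵀ * diagonal (fun i => (σ i : ℂ)) * W := by
  let T : EuclideanSpace ℂ (Fin n) →ₛₗ[starRingEnd ℂ] EuclideanSpace ℂ (Fin n) :=
    { toFun := fun x => WithLp.toLp 2 (A *ᵥ star x.ofLp)
      map_add' := fun x y => by simp [mulVec_add]
      map_smul' := fun c x => by simp [mulVec_smul] }
  have hT : ∀ x y, inner ℂ x (T y) = inner ℂ y (T x) := by
    intro x y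
    simp only [T, LinearMap.coe_mk, AddHom.coe_mk, EuclideanSpace.inner_eq_star_dotProduct]
    rw [dotProduct_comm, dotProduct_mulVec, ← mulVec_transpose, hA.eq]
  obtain ⟨v, s, hv, hs⟩ := exists_orthonormal_coneigenvectors T hT n (by simp)
  -- the values `s` come unordered; `e` sorts them decreasingly
  set e := Tuple.sort (fun i => -s i)
  have hanti : Antitone (s ∘ e) := by
    intro i j hij
    have := Tuple.monotone_sort (fun i => -s i) hij
    simp only [Function.comp] at this ⊢
    linarith
  let W : Matrix (Fin n) (Fin n) ℂ := of fun i j => v (e i) j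
  have hW : W * star W = 1 := by
    ext i j
    have h := orthonormal_iff_ite.1 (hv.comp e e.injective) j i
    simp only [Function.comp, EuclideanSpace.inner_eq_star_dotProduct] at h
    rw [mul_apply, one_apply]
    simp only [W, of_apply, star_apply]
    simp only [eq_comm (a := i)]
    exact h
  have hWm : W ∈ unitaryGroup (Fin n) ℂ := mem_unitaryGroup_iff.2 hW
  refine ⟨W, hWm, s ∘ e, hanti, fun i => (hs _).1, ?_⟩
  have key : A * Wᴴ = Wᵀ * diagonal (fun i => ((s ∘ e) i : ℂ)) := by
    ext i j
    have h := congrArg (fun x => x.ofLp i) (hs (e j)).2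
    simp only [T, LinearMap.coe_mk, AddHom.coe_mk] at h
    rw [mul_diagonal, mul_apply]
    simp only [W, conjTranspose_apply, transpose_apply, of_apply, Function.comp]
    rw [mul_comm]
    exact h
  rw [← key, Matrix.mul_assoc, ← star_eq_conjTranspose, mem_unitaryGroup_iff'.1 hWm, Matrix.mul_one]

open Matrix in
/-- The diagonal of a Takagi factorization, if decreasing and nonnegative, is the vector of singular
values: both are determined by the characteristic polynomial of `Aᴴ * A`. -/
theorem matrixSingularValue_of_takagi {n : ℕ} {W : Matrix (Fin n) (Fin n) ℂ}
    (hW : W ∈ unitaryGroup (Fin n) ℂ) {σ : Fin n → ℝ} (hσ : Antitone σ) (h0 : ∀ i, 0 ≤ σ i) :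
    matrixSingularValue (Wᵀ * diagonal (fun i => (σ i : ℂ)) * W) = σ := by
  set A := Wᵀ * diagonal (fun i => (σ i : ℂ)) * W with hA
  set T := toEuclideanLin A
  have hn : Module.finrank ℂ (EuclideanSpace ℂ (Fin n)) = n := by simp
  have hadj : T.adjoint ∘ₗ T = toEuclideanLin (Aᴴ * A) := by
    rw [← toEuclideanLin_conjTranspose_eq_adjoint]
    ext x
    simp [T, toLpLin_apply]
  have hWW : W * Wᴴ = 1 := mem_unitaryGroup_iff.1 hW
  have hWt : (Wᵀ)ᴴ * Wᵀ = 1 := by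
    rw [show (Wᵀ)ᴴ = (Wᴴ)ᵀ from rfl, ← transpose_mul, hWW, transpose_one]
  have hAA : Aᴴ * A = Wᴴ * (diagonal (fun i => ((σ i ^ 2 : ℝ) : ℂ)) * W) := by
    rw [hA, conjTranspose_mul, conjTranspose_mul]
    calc _ = Wᴴ * ((diagonal fun i => (σ i : ℂ))ᴴ * (((Wᵀ)ᴴ * Wᵀ) *
            ((diagonal fun i => (σ i : ℂ)) * W))) := by simp only [Matrix.mul_assoc]
      _ = _ := by
        rw [hWt, Matrix.one_mul, diagonal_conjTranspose, ← Matrix.mul_assoc (diagonal _),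
          diagonal_mul_diagonal]
        congr 3
        ext i
        simp [sq]
  have hchar : (T.adjoint ∘ₗ T).charpoly =
      ∏ i, (Polynomial.X - Polynomial.C ((σ i ^ 2 : ℝ) : ℂ)) := by
    rw [hadj, toEuclideanLin, toLpLin_eq_toLin, charpoly_toLin, hAA, charpoly_mul_comm,
      Matrix.mul_assoc, hWW, Matrix.mul_one, charpoly_diagonal]
  have hσ2 : T.isSymmetric_adjoint_comp_self.eigenvalues hn = fun i => σ i ^ 2 := by
    rw [← List.ofFn_inj, ← LinearMap.IsSymmetric.sort_roots_charpoly_eq_eigenvalues, hchar,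
      Polynomial.roots_prod _ _ 
        (Finset.prod_ne_zero_iff.2 fun i _ => Polynomial.X_sub_C_ne_zero _)]
    have hsort : (List.ofFn fun i => σ i ^ 2).Pairwise (· ≥ ·) := by
      rw [← List.sortedGE_iff_pairwise]
      exact Antitone.sortedGE_ofFn fun i j hij => pow_le_pow_left₀ (h0 j) (hσ hij) 2
    simp only [Polynomial.roots_X_sub_C, Multiset.bind_singleton, Multiset.map_map,
      Function.comp_def, RCLike.re_to_complex, Complex.ofReal_re]
    rw [Fin.univ_val_map, Multiset.coe_sort]
    convert! List.mergeSort_of_pairwise ?_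
    simpa using hsort
  funext i
  rw [matrixSingularValue, LinearMap.singularValues_fin _ hn]
  change √(T.isSymmetric_adjoint_comp_self.eigenvalues hn i) = _
  rw [hσ2, Real.sqrt_sq (h0 i)]

/-! ### Rigidity of the coincidence pattern -/

section Rigidity

/-- If `g` factors through `f` and takes at least as many values, then `f` and `g` have the same
fibres. -/
theorem eq_of_eq_of_card_image_le {ι : Type*} [Fintype ι] {f g : ι → ℝ}
    (hfg : ∀ a b, f a = f b → g a = g b)
    (hcard : (Finset.univ.image f).card ≤ (Finset.univ.image g).card) {a b : ι}
    (hab : g a = g b) : f a = f b := by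
  classical
  have hF : Function.FactorsThrough g f := fun a b h => hfg a b h
  have hcomp : ∀ a, Function.extend f g 0 (f a) = g a := fun a => hF.extend_apply 0 a
  have himg : Finset.univ.image g = (Finset.univ.image f).image (Function.extend f g 0) := by
    rw [Finset.image_image]
    exact Finset.image_congr fun a _ => (hcomp a).symm
  rw [himg] at hcard
  have hinj := Finset.card_image_iff.1 (le_antisymm Finset.card_image_le hcard)
  exact hinj (by simp) (by simp) (by rw [hcomp, hcomp, hab])

theorem card_image_le_of_eq_imp {ι : Type*} [Fintype ι] {f g : ι → ℝ}
    (hfg : ∀ a b, f a = f b → g a = g b) :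
    (Finset.univ.image g).card ≤ (Finset.univ.image f).card := by
  classical
  have hF : Function.FactorsThrough g f := fun a b h => hfg a b h
  have himg : Finset.univ.image g = (Finset.univ.image f).image (Function.extend f g 0) := by
    rw [Finset.image_image]
    exact Finset.image_congr fun a _ => (hF.extend_apply 0 a).symm
  rw [himg]
  exact Finset.card_image_le

/-- The pattern of a real vector `σ`: which entries coincide, and which vanish. -/
def coincidencePattern {n : ℕ} (σ : Fin n → ℝ) : (Fin n → Fin n → Prop) × (Fin n → Prop) :=
  (fun i j => σ i = σ j, fun i => σ i = 0)

theorem coincidencePattern_eq_iff {n : ℕ} {σ τ : Fin n → ℝ} :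
    coincidencePattern σ = coincidencePattern τ ↔
      (∀ i j, σ i = σ j ↔ τ i = τ j) ∧ ∀ i, σ i = 0 ↔ τ i = 0 := by
  simp only [coincidencePattern, Prod.mk.injEq, funext_iff, eq_iff_iff]

open Matrix

/-- Let `B` be block diagonal for the classes of equal `σ i` and close to `diag σ`. Then `(B w) j` is
close to `σ j * w j`, relative to `w j`, at an index `j` where `w` is largest within its class. -/
theorem sum_block_bound {n : ℕ} {σ : Fin n → ℝ} {B : Matrix (Fin n) (Fin n) ℂ} {ε : ℝ}
    (hblock : ∀ i j, σ i ≠ σ j → B i j = 0)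
    (hnear : ∀ i j, ‖B i j - diagonal (fun i => (σ i : ℂ)) i j‖ ≤ ε) {w : Fin n → ℂ} {j : Fin n}
    (hmax : ∀ l, σ l = σ j → ‖w l‖ ≤ ‖w j‖) :
    ‖∑ l, B j l * w l - σ j * w j‖ ≤ n * ε * ‖w j‖ := by
  have h1 : ∑ l, B j l * w l - σ j * w j
      = ∑ l, (B j l - diagonal (fun i => (σ i : ℂ)) j l) * w l := by
    simp only [sub_mul, Finset.sum_sub_distrib]
    congr 1
    simp [diagonal_apply]
  have h2 : ∀ l ∈ Finset.univ,
      ‖(B j l - diagonal (fun i => (σ i : ℂ)) j l) * w l‖ ≤ ε * ‖w j‖ := by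
    intro l _
    rw [norm_mul]
    by_cases hl : σ l = σ j
    · exact mul_le_mul (hnear _ _) (hmax l hl) (norm_nonneg _) ((norm_nonneg _).trans (hnear j l))
    · rw [hblock j l (Ne.symm hl), diagonal_apply_ne _ (fun h => hl (by rw [h])), sub_zero, norm_zero,
        zero_mul]
      exact mul_nonneg ((norm_nonneg _).trans (hnear j l)) (norm_nonneg _)
  rw [h1]
  refine (norm_sum_le_of_le _ h2).trans (le_of_eq ?_)
  simp [mul_assoc]

theorem exists_max_in_class {n : ℕ} (σ : Fin n → ℝ) (w : Fin n → ℂ) (i : Fin n) :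
    ∃ j, σ j = σ i ∧ ∀ l, σ l = σ i → ‖w l‖ ≤ ‖w j‖ := by
  obtain ⟨j, hj, hmax⟩ := Finset.exists_max_image (Finset.univ.filter fun j => σ j = σ i)
    (fun l => ‖w l‖) ⟨i, by simp⟩
  exact ⟨j, by simpa using hj, fun l hl => hmax l (by simpa using hl)⟩

/-- Let `B`, with Takagi factorization `Wᵀ * diag τ * W`, be a small block diagonal perturbation of
`diag σ`, real on the blocks with `σ i ≠ 0`. If `τ` has the coincidence pattern of `σ`, then `B` is
diagonal, constant on each class, and zero on the class of `σ i = 0`.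

Each row of `W` is a coneigenvector of `B`. Comparing largest entries, a row that is nonzero on a
class has its `τ k` close to the value of `σ` there; counting the values of `σ` and `τ` shows that
`τ` is constant on the rows living on a class. On a class with `σ i ≠ 0` the rows are moreover real,
because `B` is real and positive there, so that the sum for `B i j` is a multiple of
`(Wᴴ * W) j i`. -/
theorem block_rigidity {n : ℕ} {σ τ : Fin n → ℝ} {B W : Matrix (Fin n) (Fin n) ℂ} {ε : ℝ}
    (hW : W ∈ unitaryGroup (Fin n) ℂ) (hB : B = Wᵀ * diagonal (fun i => (τ i : ℂ)) * W)
    (hσ0 : ∀ i, 0 ≤ σ i) (hτ0 : ∀ i, 0 ≤ τ i)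
    (hpat : coincidencePattern τ = coincidencePattern σ)
    (hblock : ∀ i j, σ i ≠ σ j → B i j = 0)
    (hreal : ∀ i j, σ i ≠ 0 → (B i j).im = 0)
    (hnear : ∀ i j, ‖B i j - diagonal (fun i => (σ i : ℂ)) i j‖ ≤ ε)
    (hgap : ∀ i j, σ i ≠ σ j → 2 * (n * ε) < |σ i - σ j|)
    (hpos : ∀ i, σ i ≠ 0 → n * ε < σ i) :
    (∀ i j, i ≠ j → B i j = 0) ∧ (∀ i j, σ i = σ j → B i i = B j j) ∧
      ∀ i, σ i = 0 → B i i = 0 := by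
  rw [coincidencePattern_eq_iff] at hpat
  have hWW : W * Wᴴ = 1 := mem_unitaryGroup_iff.1 hW
  have hWW' : Wᴴ * W = 1 := mem_unitaryGroup_iff'.1 hW
  -- the rows of `W` are coneigenvectors of `B`
  have hrow : ∀ k i, ∑ l, B i l * star (W k l) = τ k * W k i := by
    intro k i
    have h : B * Wᴴ = Wᵀ * diagonal (fun i => (τ i : ℂ)) := by
      rw [hB, Matrix.mul_assoc, hWW, Matrix.mul_one]
    have := congrFun (congrFun h i) k
    rw [mul_apply, mul_diagonal, transpose_apply, mul_comm] at this
    exact this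
  -- a row that does not vanish on a class has its value `τ k` near the value of `σ` on the class
  have hnear1 : ∀ k i, W k i ≠ 0 → |τ k - σ i| ≤ n * ε := by
    intro k i hki
    obtain ⟨j, hj, hmax⟩ := exists_max_in_class σ (fun l => star (W k l)) i
    have h := sum_block_bound hblock hnear (w := fun l => star (W k l)) (j := j)
      (fun l hl => hmax l (hl.trans hj))
    rw [hrow] at h
    have hpos : 0 < ‖W k j‖ := by
      have := hmax i rfl
      rw [norm_star, norm_star] at this
      exact (norm_pos_iff.2 hki).trans_le this
    have h3 := (abs_norm_sub_norm_le _ _).trans h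
    rw [norm_mul, norm_mul, norm_star, Complex.norm_real, Complex.norm_real,
      Real.norm_of_nonneg (hτ0 k), Real.norm_of_nonneg (hσ0 j), ← sub_mul, abs_mul,
      abs_of_pos hpos, hj] at h3
    exact le_of_mul_le_mul_right h3 hpos
  have hrow_ne : ∀ k, ∃ i, W k i ≠ 0 := by
    intro k
    by_contra! h
    have := congrFun (congrFun hWW k) k
    rw [mul_apply, one_apply_eq] at this
    simp [h] at this
  have hcol_ne : ∀ i, ∃ k, W k i ≠ 0 := by
    intro i
    by_contra! h
    have := congrFun (congrFun hWW' i) i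
    rw [mul_apply, one_apply_eq] at this
    simp [h] at this
  choose c hc using hrow_ne
  have hclass : ∀ k k' i i', τ k = τ k' → W k i ≠ 0 → W k' i' ≠ 0 → σ i = σ i' := by
    intro k k' i i' hkk h h'
    by_contra hne
    have h1 := hnear1 k i h
    have h2 := hnear1 k' i' h'
    rw [← hkk, abs_sub_comm] at h2
    rw [abs_sub_comm] at h1
    have h3 := hgap i i' hne
    have h4 := abs_sub_le (σ i) (τ k) (σ i')
    rw [abs_sub_comm] at h2
    linarith
  have himage : Finset.univ.image σ ⊆ Finset.univ.image (σ ∘ c) := by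
    intro x hx
    obtain ⟨i, -, rfl⟩ := Finset.mem_image.1 hx
    obtain ⟨k, hk⟩ := hcol_ne i
    exact Finset.mem_image.2 ⟨k, Finset.mem_univ _, hclass k k _ _ rfl (hc k) hk⟩
  -- rows supported on the same class have the same singular value, by counting
  have hcount : ∀ k k', σ (c k) = σ (c k') → τ k = τ k' := by
    intro k k' h
    refine eq_of_eq_of_card_image_le (f := τ) (g := σ ∘ c)
      (fun a b hab => hclass a b _ _ hab (hc a) (hc b)) ?_ h
    exact (card_image_le_of_eq_imp (f := σ) (g := τ) fun a b hab => (hpat.1 a b).2 hab).trans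
      (Finset.card_le_card himage)
  have hcount' : ∀ k k' i i', W k i ≠ 0 → W k' i' ≠ 0 → σ i = σ i' → τ k = τ k' := by
    intro k k' i i' h h' hii
    exact hcount k k' (((hclass k k _ _ rfl (hc k) h).trans hii).trans
      (hclass k' k' _ _ rfl h' (hc k')))
  -- The imaginary part `y` of a row satisfies `B y = -τ k • y` on a class where `B` is real and close
  -- to `σ j > 0`; as `τ k ≥ 0`, this forces `y = 0`.
  have hWreal : ∀ k i, σ i ≠ 0 → (W k i).im = 0 := by
    intro k i hi
    obtain ⟨j, hj, hmax⟩ := exists_max_in_class σ (fun l => ((W k l).im : ℂ)) i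
    have hj0 : σ j ≠ 0 := by rwa [hj]
    have h := sum_block_bound hblock hnear (w := fun l => ((W k l).im : ℂ)) (j := j)
      (fun l hl => hmax l (hl.trans hj))
    have him : ∑ l, B j l * ((W k l).im : ℂ) = -(τ k * (W k j).im) := by
      have h1 : ∀ l, B j l * ((W k l).im : ℂ) = -((B j l * star (W k l)).im : ℂ) := by
        intro l
        apply Complex.ext <;> simp [Complex.mul_im, hreal j l hj0]
      rw [Finset.sum_congr rfl fun l _ => h1 l, Finset.sum_neg_distrib]
      rw [← Complex.ofReal_sum, ← Complex.im_sum, hrow]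
      simp [Complex.mul_im]
    rw [him, ← norm_neg] at h
    have h2 : -(-((τ k : ℂ) * (W k j).im) - σ j * (W k j).im)
        = (((τ k + σ j) * (W k j).im : ℝ) : ℂ) := by push_cast; ring
    rw [h2, Complex.norm_real, Complex.norm_real, norm_mul,
      Real.norm_of_nonneg (add_nonneg (hτ0 k) (hσ0 j))] at h
    have hj1 : ‖(W k j).im‖ = 0 := by
      by_contra hne
      have hlt : 0 < ‖(W k j).im‖ := lt_of_le_of_ne (norm_nonneg _) (Ne.symm hne)
      have h3 := le_of_mul_le_mul_right h hlt
      have h4 := hpos j hj0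
      have h5 := hτ0 k
      linarith
    have h6 := hmax i rfl
    rw [Complex.norm_real, Complex.norm_real, hj1] at h6
    exact norm_eq_zero.1 (le_antisymm h6 (norm_nonneg _))
  -- The class of zeros of `σ` carries the zeros of `τ`: if `τ i = 0`, the row `i` lives on a class
  -- with `σ` close to `0`, hence equal to `0`.
  have hτzero : ∀ k i, σ i = 0 → W k i ≠ 0 → τ k = 0 := by
    intro k i hi hki
    have hτi : τ i = 0 := (hpat.2 i).2 hi
    have hci : σ (c i) = 0 := by
      by_contra hne
      have h1 := hnear1 i _ (hc i)
      have h2 := hpos _ hne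
      rw [hτi, zero_sub, abs_neg, abs_of_nonneg (hσ0 _)] at h1
      linarith
    rw [← hτi]
    exact hcount' k i i (c i) hki (hc i) (hi.trans hci.symm)
  have hBij : ∀ i j, B i j = ∑ k, W k i * τ k * W k j := by
    intro i j
    rw [hB, mul_apply]
    simp [mul_diagonal]
  have hBzero : ∀ i j, σ i = 0 → B i j = 0 := by
    intro i j hi
    rw [hBij]
    refine Finset.sum_eq_zero fun k _ => ?_
    by_cases hk : W k i = 0
    · simp [hk]
    · simp [hτzero k i hi hk]
  have hBij' : ∀ i j k₀, σ i = σ j → σ i ≠ 0 → W k₀ i ≠ 0 →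
      B i j = τ k₀ * (1 : Matrix (Fin n) (Fin n) ℂ) j i := by
    intro i j k₀ hij hi hk₀
    rw [hBij, ← hWW', mul_apply, Finset.mul_sum]
    refine Finset.sum_congr rfl fun k _ => ?_
    have hstar : star (W k j) = W k j := Complex.conj_eq_iff_im.2 (hWreal k j (hij ▸ hi))
    rw [conjTranspose_apply, hstar]
    by_cases hk : W k i = 0
    · simp [hk]
    · rw [hcount' k k₀ i i hk hk₀ rfl]
      ring
  refine ⟨fun i j hij => ?_, fun i j hij => ?_, fun i hi => hBzero i i hi⟩
  · by_cases h : σ i = σ j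
    · by_cases hi : σ i = 0
      · exact hBzero i j hi
      · obtain ⟨k₀, hk₀⟩ := hcol_ne i
        rw [hBij' i j k₀ h hi hk₀, one_apply_ne hij.symm, mul_zero]
    · exact hblock i j h
  · by_cases hi : σ i = 0
    · rw [hBzero i i hi, hBzero j j (hij ▸ hi)]
    · obtain ⟨k₀, hk₀⟩ := hcol_ne i
      obtain ⟨k₁, hk₁⟩ := hcol_ne j
      rw [hBij' i i k₀ rfl hi hk₀, hBij' j j k₁ rfl (hij ▸ hi) hk₁, one_apply_eq, one_apply_eq,
        hcount' k₀ k₁ i j hk₀ hk₁ hij]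

end Rigidity

/-! ### Slice charts from local parametrizations -/

section SliceCharts

open Topology

variable {E : Type*} [NormedAddCommGroup E] [NormedSpace ℝ E]

/-- By the inverse function theorem it suffices to parametrize a neighbourhood of each point of `M` by
a smooth map with invertible derivative at `0` that takes a `d`-dimensional subspace onto `M`. -/
theorem isSmoothSubmanifold_of_localParam [FiniteDimensional ℝ E] {M : Set E} {d : ℕ}
    (h : ∀ x ∈ M, ∃ (Φ : E → E) (e : E ≃L[ℝ] E) (L : Submodule ℝ E),
      ContDiff ℝ ∞ Φ ∧ HasFDerivAt Φ (e : E →L[ℝ] E) 0 ∧ Φ 0 = x ∧ Module.finrank ℝ L = d ∧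
        ∀ᶠ y in 𝓝 0, Φ y ∈ M ↔ y ∈ L) :
    IsSmoothSubmanifold M d := by
  have := FiniteDimensional.complete ℝ E
  intro x hx
  obtain ⟨Φ, e, L, hΦ, hΦ', hx0, hd, hL⟩ := h x hx
  have h0 : (∞ : WithTop ℕ∞) ≠ 0 := by simp
  set ψ := hΦ.contDiffAt.toOpenPartialHomeomorph Φ hΦ' h0
  -- Smoothness of the inverse is needed on a whole neighbourhood, so the chart is restricted to an
  -- open set where the derivative is invertible and `L` describes `M`.
  have hinv : ∀ᶠ y in 𝓝 (0 : E), fderiv ℝ Φ y ∈ Set.range ((↑) : (E ≃L[ℝ] E) → E →L[ℝ] E) := by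
    refine (hΦ.continuous_fderiv h0).continuousAt.eventually_mem
      (ContinuousLinearEquiv.isOpen.mem_nhds ?_)
    rw [hΦ'.fderiv]
    exact ⟨e, rfl⟩
  obtain ⟨s, hs, hso, hs0⟩ := eventually_nhds_iff.1 (hinv.and hL)
  have hψcoe : ∀ y, ψ y = Φ y := fun y => rfl
  set φ := (ψ.restrOpen s hso).symm with hφ
  have hsrc : φ.source = (ψ.restrOpen s hso).target := rfl
  have htgt : φ.target = ψ.source ∩ s := rfl
  have h0tgt : (0 : E) ∈ φ.target :=
    ⟨hΦ.contDiffAt.mem_toOpenPartialHomeomorph_source hΦ' h0, hs0⟩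
  have hsymm : ∀ y, φ.symm y = Φ y := fun y => rfl
  refine ⟨φ, L, ?_, ?_, ?_, hd, ?_⟩
  · rw [← hx0, ← hsymm]
    exact φ.map_target h0tgt
  · intro y hy
    have hy' : φ y ∈ s := (φ.map_source hy).2
    obtain ⟨e', he'⟩ := (hs _ hy').1
    refine ((ψ.restrOpen s hso).contDiffAt_symm (f₀' := e') hy ?_ ?_).contDiffWithinAt
    · rw [he']
      exact (hΦ.differentiable h0 _).hasFDerivAt
    · exact hΦ.contDiffAt
  · exact hΦ.contDiffOn
  · intro y hy
    have hy' : φ y ∈ s := (φ.map_source hy).2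
    rw [← (hs _ hy').2, ← hsymm, φ.left_inv hy]

end SliceCharts

/-! ### Dimensions -/

section Dimension

theorem symmMatrices_apply_comm {n : ℕ} (X : symmMatrices n) (i j : Fin n) :
    (X : Matrix (Fin n) (Fin n) ℂ) i j = (X : Matrix (Fin n) (Fin n) ℂ) j i :=
  Matrix.IsSymm.apply X.2 j i

/-- A symmetric matrix is a function on unordered pairs of indices. -/
noncomputable def symmMatricesEquiv (n : ℕ) : symmMatrices n ≃ₗ[ℝ] (Sym2 (Fin n) → ℂ) where
  toFun X := Sym2.lift ⟨fun i j => (X : Matrix (Fin n) (Fin n) ℂ) i j, symmMatrices_apply_comm X⟩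
  invFun f := ⟨Matrix.of fun i j => f s(i, j), by
    ext i j
    simp [Sym2.eq_swap]⟩
  map_add' X Y := by
    ext p
    induction p using Sym2.ind
    simp
  map_smul' c X := by
    ext p
    induction p using Sym2.ind
    simp
  left_inv X := by
    ext i j
    simp
  right_inv f := by
    ext p
    induction p using Sym2.ind
    simp

theorem finrank_symmMatrices (n : ℕ) : Module.finrank ℝ (symmMatrices n) = n ^ 2 + n := by
  rw [(symmMatricesEquiv n).finrank_eq, Module.finrank_pi_fintype]
  simp only [Complex.finrank_real_complex, Finset.sum_const, Finset.card_univ, smul_eq_mul]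
  rw [← Nat.card_eq_fintype_card, Sym2.natCard, Nat.card_fin, Nat.choose_two_right,
    Nat.add_sub_cancel, Nat.div_mul_cancel]
  · ring
  · rw [mul_comm]
    exact (Nat.even_mul_succ_self n).two_dvd

/-- The linear equations cut out by a pattern `p` (`p.1` is the relation of equality of entries, `p.2`
their vanishing) in slice coordinates: on each class `X` has diagonal real part constant and
off-diagonal real part zero, and `X` vanishes on the class of zeros. -/
def patternSpace {n : ℕ} (p : (Fin n → Fin n → Prop) × (Fin n → Prop)) :
    Submodule ℝ (symmMatrices n) where
  carrier := {X | ∀ i j, p.1 i j →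
    (i ≠ j → ((X : Matrix (Fin n) (Fin n) ℂ) i j).re = 0) ∧
    ((X : Matrix (Fin n) (Fin n) ℂ) i i).re = ((X : Matrix (Fin n) (Fin n) ℂ) j j).re ∧
    (p.2 i → (X : Matrix (Fin n) (Fin n) ℂ) i j = 0)}
  zero_mem' i j _ := by simp
  add_mem' {X Y} hX hY i j hij := by
    obtain ⟨h1, h2, h3⟩ := hX i j hij
    obtain ⟨h4, h5, h6⟩ := hY i j hij
    refine ⟨fun h => ?_, ?_, fun h => ?_⟩
    · simp [h1 h, h4 h]
    · simp [h2, h5]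
    · simp [h3 h, h6 h]
  smul_mem' c X hX i j hij := by
    obtain ⟨h1, h2, h3⟩ := hX i j hij
    refine ⟨fun h => ?_, ?_, fun h => ?_⟩
    · simp [h1 h]
    · simp [h2]
    · simp [h3 h]

theorem mem_patternSpace {n : ℕ} {p : (Fin n → Fin n → Prop) × (Fin n → Prop)}
    {X : symmMatrices n} : X ∈ patternSpace p ↔ ∀ i j, p.1 i j →
      (i ≠ j → ((X : Matrix (Fin n) (Fin n) ℂ) i j).re = 0) ∧
      ((X : Matrix (Fin n) (Fin n) ℂ) i i).re = ((X : Matrix (Fin n) (Fin n) ℂ) j j).re ∧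
      (p.2 i → (X : Matrix (Fin n) (Fin n) ℂ) i j = 0) := Iff.rfl

theorem finrank_ker_add_two {n : ℕ} (f : symmMatrices n →ₗ[ℝ] ℂ) (hf : Function.Surjective f) :
    Module.finrank ℝ (LinearMap.ker f) + 2 = n ^ 2 + n := by
  have h := f.finrank_range_add_finrank_ker
  rw [LinearMap.range_eq_top.2 hf, finrank_top, Complex.finrank_real_complex,
    finrank_symmMatrices] at h
  omega

/-- The diagonal entry `X a a` as a real linear map. -/
def diagEntry {n : ℕ} (a : Fin n) : symmMatrices n →ₗ[ℝ] ℂ where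
  toFun X := (X : Matrix (Fin n) (Fin n) ℂ) a a
  map_add' _ _ := rfl
  map_smul' _ _ := rfl

theorem diagEntry_surjective {n : ℕ} (a : Fin n) : Function.Surjective (diagEntry a) := fun z =>
  ⟨⟨Matrix.diagonal fun _ => z, Matrix.isSymm_diagonal _⟩, Matrix.diagonal_apply_eq _ a⟩

/-- The two real linear forms `Re (X a a - X b b)` and `Re (X a b)` that vanish on the pattern space
of a coincidence of the entries `a` and `b`, combined into one complex number. -/
def repeatedEntry {n : ℕ} (a b : Fin n) : symmMatrices n →ₗ[ℝ] ℂ where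
  toFun X := ⟨((X : Matrix (Fin n) (Fin n) ℂ) a a).re - ((X : Matrix (Fin n) (Fin n) ℂ) b b).re,
    ((X : Matrix (Fin n) (Fin n) ℂ) a b).re⟩
  map_add' X Y := by
    apply Complex.ext <;> simp
    ring
  map_smul' c X := by
    apply Complex.ext <;> simp
    ring

theorem repeatedEntry_surjective {n : ℕ} {a b : Fin n} (hab : a ≠ b) :
    Function.Surjective (repeatedEntry a b) := by
  intro z
  refine ⟨⟨Matrix.of fun i j => if i = j then (if i = a then (z.re : ℂ) else 0) else z.im, ?_⟩, ?_⟩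
  · ext i j
    by_cases h : i = j
    · simp [h]
    · simp [h, Ne.symm h]
  · apply Complex.ext <;> simp [repeatedEntry, hab, hab.symm]

theorem finrank_patternSpace_add_two_le_of_eq {n : ℕ}
    {p : (Fin n → Fin n → Prop) × (Fin n → Prop)} {a b : Fin n} (hab : a ≠ b) (hp : p.1 a b) :
    Module.finrank ℝ (patternSpace p) + 2 ≤ n ^ 2 + n := by
  rw [← finrank_ker_add_two _ (repeatedEntry_surjective hab)]
  refine Nat.add_le_add_right (Submodule.finrank_mono fun X hX => ?_) 2
  obtain ⟨h1, h2, -⟩ := hX a b hp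
  exact Complex.ext (sub_eq_zero.2 h2) (h1 hab)

theorem finrank_patternSpace_add_two_le_of_zero {n : ℕ}
    {p : (Fin n → Fin n → Prop) × (Fin n → Prop)} {a : Fin n} (hpa : p.1 a a) (hp : p.2 a) :
    Module.finrank ℝ (patternSpace p) + 2 ≤ n ^ 2 + n := by
  rw [← finrank_ker_add_two _ (diagEntry_surjective a)]
  exact Nat.add_le_add_right (Submodule.finrank_mono fun X hX => (hX a a hpa).2.2 hp) 2

theorem finrank_patternSpace_of_single_pair {n : ℕ} {σ : Fin n → ℝ} {a b : Fin n} (hab : a ≠ b)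
    (h0 : ∀ i, σ i ≠ 0) (heq : σ a = σ b)
    (hσ : ∀ i j, σ i = σ j → i = j ∨ (i = a ∧ j = b) ∨ (i = b ∧ j = a)) :
    Module.finrank ℝ (patternSpace (coincidencePattern σ)) + 2 = n ^ 2 + n := by
  refine le_antisymm (finrank_patternSpace_add_two_le_of_eq hab heq) ?_
  rw [← finrank_ker_add_two _ (repeatedEntry_surjective hab)]
  refine Nat.add_le_add_right (Submodule.finrank_mono fun X hX i j hij => ?_) 2
  have hre : ((X : Matrix (Fin n) (Fin n) ℂ) a a).re = ((X : Matrix (Fin n) (Fin n) ℂ) b b).re :=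
    sub_eq_zero.1 (congrArg Complex.re hX)
  have him : ((X : Matrix (Fin n) (Fin n) ℂ) a b).re = 0 := congrArg Complex.im hX
  refine ⟨fun hne => ?_, ?_, fun h => absurd h (h0 i)⟩
  · obtain h | ⟨rfl, rfl⟩ | ⟨rfl, rfl⟩ := hσ i j hij
    · exact absurd h hne
    · exact him
    · rwa [symmMatrices_apply_comm]
  · obtain rfl | ⟨rfl, rfl⟩ | ⟨rfl, rfl⟩ := hσ i j hij
    exacts [rfl, hre, hre.symm]

theorem finrank_patternSpace_of_single_zero {n : ℕ} {σ : Fin n → ℝ} {a : Fin n}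
    (hinj : Function.Injective σ) (ha : σ a = 0) :
    Module.finrank ℝ (patternSpace (coincidencePattern σ)) + 2 = n ^ 2 + n := by
  refine le_antisymm (finrank_patternSpace_add_two_le_of_zero (a := a) rfl ha) ?_
  rw [← finrank_ker_add_two _ (diagEntry_surjective a)]
  refine Nat.add_le_add_right (Submodule.finrank_mono fun X hX i j hij => ?_) 2
  obtain rfl := hinj hij
  refine ⟨fun h => absurd rfl h, rfl, fun h => ?_⟩
  obtain rfl : i = a := hinj (h.trans ha.symm)
  exact hX

end Dimension

/-! ### The slice for the action of the unitary group -/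

section ExpDerivative

open NormedSpace

variable {E 𝔸 : Type*} [NormedAddCommGroup E] [NormedSpace ℝ E] [NormedRing 𝔸] [NormedAlgebra ℝ 𝔸]
  [CompleteSpace 𝔸]

theorem hasFDerivAt_exp_mul_exp (F G H L : E →L[ℝ] 𝔸) (C P Q : 𝔸)
    (hL : ∀ X, L X = P * (F X * C + G X + C * H X) * Q) :
    HasFDerivAt (fun X => P * (exp (F X) * (C + G X) * exp (H X)) * Q) L 0 := by
  have h1 : ∀ f : E →L[ℝ] 𝔸, HasFDerivAt (fun X => exp (f X)) f 0 := fun f => by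
    have h := hasFDerivAt_exp_zero (𝕂 := ℝ) (𝔸 := 𝔸)
    rw [← map_zero f] at h
    exact h.comp 0 f.hasFDerivAt
  have h2 := (h1 F).mul' ((hasFDerivAt_const C 0).add (G.hasFDerivAt (x := 0)))
  have h3 := ((h2.mul' (h1 H)).const_mul P).mul_const' Q
  refine h3.congr_fderiv ?_
  ext X
  rw [hL]
  simp [mul_add, add_mul, add_comm, add_left_comm]

theorem contDiff_exp_mul_exp (F G H : E →L[ℝ] 𝔸) (C P Q : 𝔸) :
    ContDiff ℝ ∞ (fun X => P * (exp (F X) * (C + G X) * exp (H X)) * Q) := by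
  have h0 : ContDiff ℝ ∞ (exp : 𝔸 → 𝔸) :=
    contDiff_iff_contDiffAt.2 fun x => (exp_analytic (𝕂 := ℝ) x).contDiffAt
  have h1 : ∀ f : E →L[ℝ] 𝔸, ContDiff ℝ ∞ fun X => exp (f X) := fun f => h0.comp f.contDiff
  exact (contDiff_const.mul (((h1 _).mul (contDiff_const.add G.contDiff)).mul (h1 _))).mul
    contDiff_const

end ExpDerivative

section SliceMap

open Matrix NormedSpace

variable {n : ℕ}

/-- The skew-Hermitian part `S` of the splitting `X = Sᵀ * diag σ + D + diag σ * S`. Dividing by zero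
gives zero: `Re X i j` is dropped if `σ i = σ j`, and `Im X i j` if `σ i + σ j = 0`. -/
noncomputable def skewPart (σ : Fin n → ℝ) : symmMatrices n →ₗ[ℝ] Matrix (Fin n) (Fin n) ℂ where
  toFun X := of fun i j => ⟨((X : Matrix (Fin n) (Fin n) ℂ) i j).re / (σ i - σ j),
    ((X : Matrix (Fin n) (Fin n) ℂ) i j).im / (σ i + σ j)⟩
  map_add' X Y := by
    ext i j
    apply Complex.ext <;> simp [add_div]
  map_smul' c X := by
    ext i j
    apply Complex.ext <;> simp [mul_div_assoc]

open Classical in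
/-- The part `D` of the splitting `X = Sᵀ * diag σ + D + diag σ * S`: the real parts of the entries
with `σ i = σ j` and the imaginary parts of those with `σ i + σ j = 0`. -/
noncomputable def slicePart (σ : Fin n → ℝ) : symmMatrices n →ₗ[ℝ] Matrix (Fin n) (Fin n) ℂ where
  toFun X := of fun i j => ⟨if σ i = σ j then ((X : Matrix (Fin n) (Fin n) ℂ) i j).re else 0,
    if σ i + σ j = 0 then ((X : Matrix (Fin n) (Fin n) ℂ) i j).im else 0⟩
  map_add' X Y := by
    ext i j
    apply Complex.ext <;> simp <;> split_ifs <;> simp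
  map_smul' c X := by
    ext i j
    apply Complex.ext <;> simp

theorem skewPart_mem_skewAdjoint (σ : Fin n → ℝ) (X : symmMatrices n) :
    skewPart σ X ∈ skewAdjoint (Matrix (Fin n) (Fin n) ℂ) := by
  rw [skewAdjoint.mem_iff]
  ext i j
  rw [star_apply, neg_apply]
  simp only [skewPart, LinearMap.coe_mk, AddHom.coe_mk, of_apply]
  rw [symmMatrices_apply_comm X j i]
  apply Complex.ext
  · simp [← div_neg]
  · simp [add_comm]

theorem slicePart_isSymm (σ : Fin n → ℝ) (X : symmMatrices n) : (slicePart σ X).IsSymm := by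
  ext i j
  simp only [slicePart, LinearMap.coe_mk, AddHom.coe_mk, of_apply, transpose_apply]
  rw [symmMatrices_apply_comm X j i]
  simp only [eq_comm (a := σ j), add_comm (σ j)]

theorem skewPart_add_slicePart (σ : Fin n → ℝ) (X : symmMatrices n) :
    (skewPart σ X)ᵀ * diagonal (fun i => (σ i : ℂ)) + slicePart σ X +
      diagonal (fun i => (σ i : ℂ)) * skewPart σ X = X := by
  ext i j
  rw [Matrix.add_apply, Matrix.add_apply, mul_diagonal, diagonal_mul, transpose_apply]
  simp only [skewPart, slicePart, LinearMap.coe_mk, AddHom.coe_mk, of_apply]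
  rw [symmMatrices_apply_comm X j i]
  apply Complex.ext
  · by_cases h : σ i = σ j
    · simp [h]
    · have h1 : σ i - σ j ≠ 0 := sub_ne_zero.2 h
      have h2 : σ j - σ i ≠ 0 := sub_ne_zero.2 (Ne.symm h)
      simp [h]
      field_simp
      ring
  · by_cases h : σ i + σ j = 0
    · have h' : σ j + σ i = 0 := by rw [add_comm, h]
      simp [h, h']
    · have h' : σ j + σ i ≠ 0 := by rwa [add_comm]
      simp [h]
      field_simp
      ring

local notation "𝔄" => (EuclideanSpace ℂ (Fin n) →L[ℂ] EuclideanSpace ℂ (Fin n))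

/-- Matrices as operators on `ℂⁿ`, a complete normed algebra; the sup norm on matrices is not
submultiplicative, so the calculus of the exponential is done in operators. -/
noncomputable def toOperator : Matrix (Fin n) (Fin n) ℂ →L[ℝ] 𝔄 :=
  LinearMap.toContinuousLinearMap
    (((toEuclideanCLM (n := Fin n) (𝕜 := ℂ)).toAlgEquiv.toLinearMap).restrictScalars ℝ)

theorem toOperator_apply (A : Matrix (Fin n) (Fin n) ℂ) :
    toOperator A = toEuclideanCLM (n := Fin n) (𝕜 := ℂ) A := rfl

theorem toOperator_mul (A B : Matrix (Fin n) (Fin n) ℂ) :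
    toOperator (A * B) = toOperator A * toOperator B :=
  map_mul (toEuclideanCLM (n := Fin n) (𝕜 := ℂ)) A B

/-- The symmetric part of the matrix of an operator, a linear left inverse of `toOperator` on
symmetric matrices. -/
noncomputable def symmOfOperator : 𝔄 →L[ℝ] symmMatrices n :=
  LinearMap.toContinuousLinearMap
    { toFun := fun T => ⟨(1 / 2 : ℝ) • ((toEuclideanCLM (n := Fin n) (𝕜 := ℂ)).symm T +
        ((toEuclideanCLM (n := Fin n) (𝕜 := ℂ)).symm T)ᵀ),
          (isSymm_add_transpose_self _).smul _⟩
      map_add' := fun S T => by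
        ext1
        simp only [map_add, transpose_add, Submodule.coe_add, ← smul_add]
        congr 1
        abel
      map_smul' := fun c T => by
        ext1
        have h : (toEuclideanCLM (n := Fin n) (𝕜 := ℂ)).symm (c • T) =
            c • (toEuclideanCLM (n := Fin n) (𝕜 := ℂ)).symm T :=
          map_smul (toEuclideanCLM (n := Fin n) (𝕜 := ℂ)).symm (c : ℂ) T
        simp only [h, transpose_smul, Submodule.coe_smul, RingHom.id_apply, ← smul_add]
        rw [smul_comm] }

theorem symmOfOperator_toOperator (X : symmMatrices n) :
    symmOfOperator (toOperator (X : Matrix (Fin n) (Fin n) ℂ)) = X := by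
  ext1
  have h : (X : Matrix (Fin n) (Fin n) ℂ)ᵀ = X := X.2
  simp only [symmOfOperator, LinearMap.coe_toContinuousLinearMap', LinearMap.coe_mk,
    AddHom.coe_mk, toOperator_apply, StarAlgEquiv.symm_apply_apply, h]
  rw [← two_smul ℝ, smul_smul]
  norm_num

open scoped Matrix.Norms.Operator in
theorem map_toEuclideanCLM_exp (A : Matrix (Fin n) (Fin n) ℂ) :
    toEuclideanCLM (n := Fin n) (𝕜 := ℂ) (exp A) = exp (toEuclideanCLM (n := Fin n) (𝕜 := ℂ) A) := by
  let : NormedAlgebra ℚ (Matrix (Fin n) (Fin n) ℂ) := .restrictScalars ℚ ℂ _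
  let : NormedAlgebra ℚ 𝔄 := .restrictScalars ℚ ℂ _
  exact map_exp (toEuclideanCLM (n := Fin n) (𝕜 := ℂ))
    (LinearMap.continuous_of_finiteDimensional
      (toEuclideanCLM (n := Fin n) (𝕜 := ℂ)).toAlgEquiv.toLinearMap) A

theorem toOperator_exp (A : Matrix (Fin n) (Fin n) ℂ) :
    toOperator (exp A) = exp (toOperator A) := map_toEuclideanCLM_exp A

theorem exp_mem_unitaryGroup {A : Matrix (Fin n) (Fin n) ℂ}
    (hA : A ∈ skewAdjoint (Matrix (Fin n) (Fin n) ℂ)) : exp A ∈ unitaryGroup (Fin n) ℂ := by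
  rw [mem_unitaryGroup_iff, star_eq_conjTranspose, ← exp_conjTranspose, ← star_eq_conjTranspose,
    skewAdjoint.mem_iff.1 hA, ← exp_add_of_commute _ _ (Commute.refl A).neg_right, add_neg_cancel,
    exp_zero]

/-- The unitary matrix by which the slice is moved and then put in position by `W`. -/
noncomputable def sliceFrame (σ : Fin n → ℝ) (W : Matrix (Fin n) (Fin n) ℂ) (X : symmMatrices n) :
    Matrix (Fin n) (Fin n) ℂ :=
  exp (skewPart σ X) * W

/-- The parametrization of a neighbourhood of `Wᵀ * diag σ * W` by symmetric matrices: the `skewPart`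
moves along the orbit of the unitary group, the `slicePart` along the slice. -/
noncomputable def sliceMap (σ : Fin n → ℝ) (W : Matrix (Fin n) (Fin n) ℂ) (X : symmMatrices n) :
    symmMatrices n :=
  ⟨(sliceFrame σ W X)ᵀ * (diagonal (fun i => (σ i : ℂ)) + slicePart σ X) * sliceFrame σ W X, by
    have h : (diagonal (fun i => (σ i : ℂ)) + slicePart σ X).IsSymm :=
      (isSymm_diagonal _).add (slicePart_isSymm σ X)
    change (_)ᵀ = _
    rw [transpose_mul, transpose_mul, transpose_transpose, h.eq, Matrix.mul_assoc]⟩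

theorem coe_sliceMap (σ : Fin n → ℝ) (W : Matrix (Fin n) (Fin n) ℂ) (X : symmMatrices n) :
    (sliceMap σ W X : Matrix (Fin n) (Fin n) ℂ) =
      (sliceFrame σ W X)ᵀ * (diagonal (fun i => (σ i : ℂ)) + slicePart σ X) *
        sliceFrame σ W X := rfl

theorem sliceFrame_mem_unitaryGroup (σ : Fin n → ℝ) {W : Matrix (Fin n) (Fin n) ℂ}
    (hW : W ∈ unitaryGroup (Fin n) ℂ) (X : symmMatrices n) :
    sliceFrame σ W X ∈ unitaryGroup (Fin n) ℂ :=
  mul_mem (exp_mem_unitaryGroup (skewPart_mem_skewAdjoint σ X)) hW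

theorem sliceMap_zero (σ : Fin n → ℝ) (W : Matrix (Fin n) (Fin n) ℂ) :
    (sliceMap σ W 0 : Matrix (Fin n) (Fin n) ℂ) = Wᵀ * diagonal (fun i => (σ i : ℂ)) * W := by
  simp [coe_sliceMap, sliceFrame]

/-- A linear map into matrices as a continuous linear map into operators. -/
noncomputable def operatorOf (f : symmMatrices n →ₗ[ℝ] Matrix (Fin n) (Fin n) ℂ) :
    symmMatrices n →L[ℝ] 𝔄 :=
  toOperator.comp (LinearMap.toContinuousLinearMap f)

theorem sliceMap_eq (σ : Fin n → ℝ) (W : Matrix (Fin n) (Fin n) ℂ) :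
    sliceMap σ W = fun X => symmOfOperator (toOperator Wᵀ *
      (exp (operatorOf ((transposeLinearEquiv (Fin n) (Fin n) ℝ ℂ).toLinearMap ∘ₗ skewPart σ) X) *
        (toOperator (diagonal fun i => (σ i : ℂ)) + operatorOf (slicePart σ) X) *
          exp (operatorOf (skewPart σ) X)) * toOperator W) := by
  funext X
  rw [← symmOfOperator_toOperator (sliceMap σ W X), coe_sliceMap, sliceFrame, transpose_mul,
    ← exp_transpose]
  congr 1
  change _ = toOperator Wᵀ * (exp (toOperator (skewPart σ X)ᵀ) *
    (toOperator (diagonal fun i => (σ i : ℂ)) + toOperator (slicePart σ X)) *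
    exp (toOperator (skewPart σ X))) * toOperator W
  simp only [toOperator_mul, map_add, toOperator_exp, mul_assoc]

theorem contDiff_sliceMap (σ : Fin n → ℝ) (W : Matrix (Fin n) (Fin n) ℂ) :
    ContDiff ℝ ∞ (sliceMap σ W) := by
  rw [sliceMap_eq]
  exact symmOfOperator.contDiff.comp (contDiff_exp_mul_exp _ _ _ _ _ _)

/-- The congruence `X ↦ Wᵀ * X * W` of symmetric matrices by a unitary `W`. -/
noncomputable def congruence (W : Matrix (Fin n) (Fin n) ℂ) (hW : W ∈ unitaryGroup (Fin n) ℂ) :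
    symmMatrices n ≃L[ℝ] symmMatrices n :=
  LinearEquiv.toContinuousLinearEquiv
    { toFun := fun X => ⟨Wᵀ * X * W, by
        have h : (X : Matrix (Fin n) (Fin n) ℂ)ᵀ = X := X.2
        change (_)ᵀ = _
        rw [transpose_mul, transpose_mul, transpose_transpose, h, Matrix.mul_assoc]⟩
      invFun := fun X => ⟨(Wᴴ)ᵀ * X * Wᴴ, by
        have h : (X : Matrix (Fin n) (Fin n) ℂ)ᵀ = X := X.2
        change (_)ᵀ = _
        rw [transpose_mul, transpose_mul, transpose_transpose, h, Matrix.mul_assoc]⟩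
      map_add' := fun X Y => by
        ext1
        simp [Matrix.mul_add, Matrix.add_mul]
      map_smul' := fun c X => by
        ext1
        simp
      left_inv := fun X => by
        have h1 : W * Wᴴ = 1 := mem_unitaryGroup_iff.1 hW
        ext1
        calc (Wᴴ)ᵀ * (Wᵀ * X * W) * Wᴴ = (W * Wᴴ)ᵀ * X * (W * Wᴴ) := by
              rw [transpose_mul]; simp only [Matrix.mul_assoc]
          _ = X := by simp [h1]
      right_inv := fun X => by
        have h1 : Wᴴ * W = 1 := mem_unitaryGroup_iff'.1 hW
        ext1
        calc Wᵀ * ((Wᴴ)ᵀ * X * Wᴴ) * W = (Wᴴ * W)ᵀ * X * (Wᴴ * W) := by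
              rw [transpose_mul]; simp only [Matrix.mul_assoc]
          _ = X := by simp [h1] }

theorem coe_congruence {W : Matrix (Fin n) (Fin n) ℂ} (hW : W ∈ unitaryGroup (Fin n) ℂ)
    (X : symmMatrices n) :
    (congruence W hW X : Matrix (Fin n) (Fin n) ℂ) = Wᵀ * X * W := rfl

theorem hasFDerivAt_sliceMap (σ : Fin n → ℝ) {W : Matrix (Fin n) (Fin n) ℂ}
    (hW : W ∈ unitaryGroup (Fin n) ℂ) :
    HasFDerivAt (sliceMap σ W) (congruence W hW : symmMatrices n →L[ℝ] symmMatrices n) 0 := by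
  rw [sliceMap_eq]
  have h := hasFDerivAt_exp_mul_exp
    (operatorOf ((transposeLinearEquiv (Fin n) (Fin n) ℝ ℂ).toLinearMap ∘ₗ skewPart σ))
    (operatorOf (slicePart σ)) (operatorOf (skewPart σ))
    (toOperator.comp ((symmMatrices n).subtypeL.comp (congruence W hW).toContinuousLinearMap))
    (toOperator (diagonal fun i => (σ i : ℂ))) (toOperator Wᵀ) (toOperator W) (fun X => by
      change toOperator (congruence W hW X : Matrix (Fin n) (Fin n) ℂ) =
        toOperator Wᵀ * (toOperator (skewPart σ X)ᵀ * toOperator (diagonal fun i => (σ i : ℂ)) +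
          toOperator (slicePart σ X) +
          toOperator (diagonal fun i => (σ i : ℂ)) * toOperator (skewPart σ X)) * toOperator W
      rw [coe_congruence, ← skewPart_add_slicePart σ X]
      simp only [toOperator_mul, map_add])
  refine (symmOfOperator.hasFDerivAt.comp 0 h).congr_fderiv ?_
  ext1 X
  exact symmOfOperator_toOperator (congruence W hW X)

end SliceMap

/-! ### The strata -/

section Strata

open Matrix Topology

variable {n : ℕ}

/-- The symmetric matrices whose decreasing vector of singular values has the coincidence pattern
`p`. -/
def singularStratum (p : (Fin n → Fin n → Prop) × (Fin n → Prop)) : Set (symmMatrices n) :=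
  {A | coincidencePattern (matrixSingularValue (A : Matrix (Fin n) (Fin n) ℂ)) = p}

theorem mem_singularStratum {p : (Fin n → Fin n → Prop) × (Fin n → Prop)} {A : symmMatrices n} :
    A ∈ singularStratum p ↔
      coincidencePattern (matrixSingularValue (A : Matrix (Fin n) (Fin n) ℂ)) = p := Iff.rfl

theorem matrixSingularValue_sliceMap {σ τ : Fin n → ℝ} {W V : Matrix (Fin n) (Fin n) ℂ}
    (hW : W ∈ unitaryGroup (Fin n) ℂ) (hV : V ∈ unitaryGroup (Fin n) ℂ) {X : symmMatrices n}
    (hτ : Antitone τ) (h0 : ∀ i, 0 ≤ τ i)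
    (h : diagonal (fun i => (σ i : ℂ)) + slicePart σ X =
      Vᵀ * diagonal (fun i => (τ i : ℂ)) * V) :
    matrixSingularValue (sliceMap σ W X : Matrix (Fin n) (Fin n) ℂ) = τ := by
  rw [← matrixSingularValue_of_takagi (mul_mem hV (sliceFrame_mem_unitaryGroup σ hW X)) hτ h0,
    coe_sliceMap, h, transpose_mul]
  simp only [Matrix.mul_assoc]

theorem re_slicePart_apply (σ : Fin n → ℝ) (X : symmMatrices n) {i j : Fin n} (h : σ i = σ j) :
    (slicePart σ X i j).re = ((X : Matrix (Fin n) (Fin n) ℂ) i j).re := by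
  simp [slicePart, h]

theorem slicePart_apply_of_ne {σ : Fin n → ℝ} (h0 : ∀ i, 0 ≤ σ i) (X : symmMatrices n)
    {i j : Fin n} (h : σ i ≠ σ j) : slicePart σ X i j = 0 := by
  have h' : σ i + σ j ≠ 0 := fun hs => h (by linarith [h0 i, h0 j])
  apply Complex.ext <;> simp [slicePart, h, h']

theorem im_slicePart_apply_of_ne_zero {σ : Fin n → ℝ} (h0 : ∀ i, 0 ≤ σ i) (X : symmMatrices n)
    {i : Fin n} (h : σ i ≠ 0) (j : Fin n) : (slicePart σ X i j).im = 0 := by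
  have h' : σ i + σ j ≠ 0 := fun hs => h (by linarith [h0 i, h0 j])
  simp [slicePart, h']

theorem slicePart_apply_of_zero {σ : Fin n → ℝ} (X : symmMatrices n)
    {i j : Fin n} (hi : σ i = 0) (hj : σ j = 0) :
    slicePart σ X i j = (X : Matrix (Fin n) (Fin n) ℂ) i j := by
  apply Complex.ext <;> simp [slicePart, hi, hj]

theorem norm_slicePart_apply_le (σ : Fin n → ℝ) (X : symmMatrices n) (i j : Fin n) :
    ‖slicePart σ X i j‖ ≤ ‖X‖ := by
  refine le_trans ?_ (norm_entry_le_entrywise_sup_norm (X : Matrix (Fin n) (Fin n) ℂ) (i := i)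
    (j := j))
  rw [Complex.norm_def, Complex.norm_def, Complex.normSq_apply, Complex.normSq_apply]
  refine Real.sqrt_le_sqrt (add_le_add ?_ ?_)
  · simp only [slicePart, LinearMap.coe_mk, AddHom.coe_mk, of_apply]
    split_ifs
    · exact le_rfl
    · simpa using mul_self_nonneg _
  · simp only [slicePart, LinearMap.coe_mk, AddHom.coe_mk, of_apply]
    split_ifs
    · exact le_rfl
    · simpa using mul_self_nonneg _

theorem slicePart_of_mem_patternSpace {σ : Fin n → ℝ} (h0 : ∀ i, 0 ≤ σ i) {X : symmMatrices n}
    (hX : X ∈ patternSpace (coincidencePattern σ)) :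
    slicePart σ X = diagonal fun i => (((X : Matrix (Fin n) (Fin n) ℂ) i i).re : ℂ) := by
  ext i j
  rw [mem_patternSpace] at hX
  by_cases hij : σ i = σ j
  · obtain ⟨h1, -, h3⟩ := hX i j hij
    by_cases hi : σ i = 0
    · rw [slicePart_apply_of_zero X hi (hij ▸ hi), h3 hi]
      by_cases h : i = j
      · subst h
        simp [h3 hi]
      · rw [diagonal_apply_ne _ h]
    · have him := im_slicePart_apply_of_ne_zero h0 X hi j
      have hre := re_slicePart_apply σ X hij
      by_cases h : i = j
      · subst h
        rw [diagonal_apply_eq]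
        exact Complex.ext (by simpa using hre) (by simpa using him)
      · rw [diagonal_apply_ne _ h]
        exact Complex.ext (by rw [hre, h1 h, Complex.zero_re]) (by rw [him, Complex.zero_im])
  · rw [slicePart_apply_of_ne h0 X hij, diagonal_apply_ne _ (fun h => hij (by rw [h]))]

/-- A perturbation bound `ε` below which entries of `σ` keep their order and stay positive; the factor
`n` is the one lost in `sum_block_bound`. -/
theorem exists_gap (σ : Fin n → ℝ) (h0 : ∀ i, 0 ≤ σ i) : ∃ ε > 0,
    (∀ i j, σ i ≠ σ j → 2 * (n * ε) < |σ i - σ j|) ∧ ∀ i, σ i ≠ 0 → n * ε < σ i := by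
  have h1 : ∀ i j, ∀ᶠ ε in 𝓝[>] (0 : ℝ), σ i ≠ σ j → 2 * (n * ε) < |σ i - σ j| := by
    intro i j
    by_cases h : σ i = σ j
    · simp [h]
    · have hc : Filter.Tendsto (fun ε : ℝ => 2 * (n * ε)) (𝓝[>] 0) (𝓝 0) :=
        ((by fun_prop : Continuous fun ε : ℝ => 2 * (n * ε)).tendsto' 0 0 (by simp)).mono_left
          nhdsWithin_le_nhds
      filter_upwards [hc.eventually_lt_const (abs_pos.2 (sub_ne_zero.2 h))] with ε hε _ using hε
  have h2 : ∀ i, ∀ᶠ ε in 𝓝[>] (0 : ℝ), σ i ≠ 0 → n * ε < σ i := by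
    intro i
    by_cases h : σ i = 0
    · simp [h]
    · have hc : Filter.Tendsto (fun ε : ℝ => n * ε) (𝓝[>] 0) (𝓝 0) :=
        ((by fun_prop : Continuous fun ε : ℝ => n * ε).tendsto' 0 0 (by simp)).mono_left
          nhdsWithin_le_nhds
      filter_upwards [hc.eventually_lt_const (lt_of_le_of_ne (h0 i) (Ne.symm h))] with ε hε _
        using hε
  obtain ⟨ε, ⟨h3, h4⟩, h5⟩ := (((Filter.eventually_all.2 fun i => Filter.eventually_all.2 (h1 i)).and
    (Filter.eventually_all.2 h2)).and self_mem_nhdsWithin).exists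
  exact ⟨ε, h5, h3, h4⟩

/-- Near `0` the slice parametrization takes exactly the pattern space into the stratum. -/
theorem eventually_sliceMap_mem_singularStratum {σ : Fin n → ℝ} (hσ : Antitone σ)
    (h0 : ∀ i, 0 ≤ σ i) {W : Matrix (Fin n) (Fin n) ℂ} (hW : W ∈ unitaryGroup (Fin n) ℂ) :
    ∀ᶠ X in 𝓝 (0 : symmMatrices n), sliceMap σ W X ∈ singularStratum (coincidencePattern σ) ↔
      X ∈ patternSpace (coincidencePattern σ) := by
  obtain ⟨ε, hε, hgap, hpos⟩ := exists_gap σ h0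
  filter_upwards [Metric.ball_mem_nhds _ hε] with X hX
  rw [mem_ball_zero_iff] at hX
  rw [mem_singularStratum, mem_patternSpace]
  have hsmall : ∀ i j, ‖slicePart σ X i j‖ ≤ ε := fun i j =>
    (norm_slicePart_apply_le σ X i j).trans hX.le
  constructor
  · intro hmem i j hij
    change σ i = σ j at hij
    obtain ⟨V, hV, τ, hτ, hτ0, hBV⟩ :=
      ((isSymm_diagonal fun i => (σ i : ℂ)).add (slicePart_isSymm σ X)).exists_takagi
    rw [matrixSingularValue_sliceMap hW hV hτ hτ0 hBV] at hmem
    obtain ⟨h1, h2, h3⟩ := block_rigidity (ε := ε) hV hBV h0 hτ0 hmem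
      (fun i j hij => by
        rw [Matrix.add_apply, slicePart_apply_of_ne h0 X hij,
          diagonal_apply_ne _ (fun h => hij (by rw [h])), add_zero])
      (fun i j hi => by
        rw [Matrix.add_apply, Complex.add_im, im_slicePart_apply_of_ne_zero h0 X hi j,
          diagonal_apply]
        split_ifs <;> simp)
      (fun i j => by
        rw [Matrix.add_apply, add_sub_cancel_left]
        exact hsmall i j) hgap hpos
    have hoff : ∀ i j, i ≠ j → slicePart σ X i j = 0 := by
      intro i j hij
      have := h1 i j hij
      rwa [Matrix.add_apply, diagonal_apply_ne _ hij, zero_add] at this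
    refine ⟨fun hne => ?_, ?_, fun hi => ?_⟩
    · rw [← re_slicePart_apply σ X hij, hoff i j hne, Complex.zero_re]
    · have h := congrArg Complex.re (h2 i j hij)
      rw [Matrix.add_apply, Matrix.add_apply, diagonal_apply_eq, diagonal_apply_eq,
        Complex.add_re, Complex.add_re, re_slicePart_apply σ X rfl, re_slicePart_apply σ X rfl,
        hij] at h
      exact add_left_cancel h
    · change σ i = 0 at hi
      rw [← slicePart_apply_of_zero X hi (hij ▸ hi)]
      by_cases h : i = j
      · subst h
        have := h3 i hi
        rwa [Matrix.add_apply, diagonal_apply_eq, hi, Complex.ofReal_zero, zero_add] at this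
      · exact hoff i j h
  · intro hmem
    have hdiag := slicePart_of_mem_patternSpace h0 (mem_patternSpace.2 hmem)
    set x : Fin n → ℝ := fun i => ((X : Matrix (Fin n) (Fin n) ℂ) i i).re with hx
    have hxε : ∀ i, |x i| ≤ n * ε := by
      intro i
      have h1 : |x i| ≤ ε := by
        have := (Complex.abs_re_le_norm _).trans (hsmall i i)
        rwa [re_slicePart_apply σ X rfl] at this
      have h2 : (1 : ℝ) ≤ n := by exact_mod_cast i.pos
      nlinarith
    have hxeq : ∀ i j, σ i = σ j → x i = x j := fun i j hij => (hmem i j hij).2.1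
    have hxzero : ∀ i, σ i = 0 → x i = 0 := fun i hi => by
      simp only [hx]
      rw [(hmem i i rfl).2.2 hi, Complex.zero_re]
    have hlt : ∀ i j, σ j < σ i → σ j + x j < σ i + x i := by
      intro i j hij
      have h1 := hgap i j hij.ne'
      rw [abs_of_pos (sub_pos.2 hij)] at h1
      linarith [(abs_le.1 (hxε i)).1, (abs_le.1 (hxε j)).2]
    have hpos' : ∀ i, σ i ≠ 0 → 0 < σ i + x i := by
      intro i hi
      linarith [hpos i hi, (abs_le.1 (hxε i)).1]
    have hanti : Antitone fun i => σ i + x i := by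
      intro i j hij
      rcases (hσ hij).lt_or_eq with h | h
      · exact (hlt i j h).le
      · simp only [h, hxeq j i h, le_refl]
    have hnonneg : ∀ i, 0 ≤ σ i + x i := by
      intro i
      by_cases hi : σ i = 0
      · rw [hi, hxzero i hi, add_zero]
      · exact (hpos' i hi).le
    rw [matrixSingularValue_sliceMap (V := 1) hW (one_mem _) hanti hnonneg (by
      rw [hdiag, diagonal_add, transpose_one, Matrix.one_mul, Matrix.mul_one]
      simp only [hx, Complex.ofReal_add]), coincidencePattern_eq_iff]
    refine ⟨fun i j => ⟨fun h => ?_, fun h => by rw [h, hxeq i j h]⟩,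
      fun i => ⟨fun h => ?_, fun h => by rw [h, hxzero i h, add_zero]⟩⟩
    · rcases lt_trichotomy (σ i) (σ j) with h' | h' | h'
      · exact absurd h (hlt j i h').ne
      · exact h'
      · exact absurd h (hlt i j h').ne'
    · by_contra hi
      exact (hpos' i hi).ne' h

theorem isSmoothSubmanifold_singularStratum (p : (Fin n → Fin n → Prop) × (Fin n → Prop)) :
    IsSmoothSubmanifold (singularStratum p) (Module.finrank ℝ (patternSpace p)) := by
  refine isSmoothSubmanifold_of_localParam fun A hA => ?_
  obtain ⟨W, hW, σ, hσ, h0, hAW⟩ := (A.2 : (A : Matrix (Fin n) (Fin n) ℂ).IsSymm).exists_takagi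
  have hp : coincidencePattern σ = p := by
    rw [mem_singularStratum, hAW, matrixSingularValue_of_takagi hW hσ h0] at hA
    exact hA
  subst hp
  exact ⟨sliceMap σ W, congruence W hW, _, contDiff_sliceMap σ W, hasFDerivAt_sliceMap σ hW,
    Subtype.ext ((sliceMap_zero σ W).trans hAW.symm), rfl,
    eventually_sliceMap_mem_singularStratum hσ h0 hW⟩

theorem singularStratum_coincidencePattern_nonempty {σ : Fin n → ℝ} (hσ : Antitone σ)
    (h0 : ∀ i, 0 ≤ σ i) : (singularStratum (coincidencePattern σ)).Nonempty := by
  refine ⟨⟨diagonal fun i => (σ i : ℂ), isSymm_diagonal _⟩, ?_⟩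
  have h := matrixSingularValue_of_takagi (one_mem (unitaryGroup (Fin n) ℂ)) hσ h0
  rw [transpose_one, Matrix.one_mul, Matrix.mul_one] at h
  rw [mem_singularStratum, h]

/-- A set of matrices defined by a condition on the pattern is the union of the strata of the patterns
satisfying it; its codimension is two if all of these have codimension at least two, and some
decreasing `σ ≥ 0` realizes equality. -/
theorem hasRealCodim_two_of_pattern (Q : (Fin n → Fin n → Prop) × (Fin n → Prop) → Prop)
    (hle : ∀ p, Q p → (singularStratum p).Nonempty →
      Module.finrank ℝ (patternSpace p) + 2 ≤ n ^ 2 + n)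
    {σ : Fin n → ℝ} (hσ : Antitone σ) (h0 : ∀ i, 0 ≤ σ i) (hQ : Q (coincidencePattern σ))
    (heq : Module.finrank ℝ (patternSpace (coincidencePattern σ)) + 2 = n ^ 2 + n) :
    HasRealCodim {A : symmMatrices n |
      Q (coincidencePattern (matrixSingularValue (A : Matrix (Fin n) (Fin n) ℂ)))} 2 := by
  refine ⟨Module.finrank ℝ (patternSpace (coincidencePattern σ)),
    by rw [heq, finrank_symmMatrices], ?_⟩
  let I := {p : (Fin n → Fin n → Prop) × (Fin n → Prop) // Q p ∧ (singularStratum p).Nonempty}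
  obtain ⟨m, ⟨e⟩⟩ := Finite.exists_equiv_fin I
  refine ⟨m, fun i => singularStratum (e.symm i).1,
    fun i => Module.finrank ℝ (patternSpace (e.symm i).1),
    fun i => ⟨(e.symm i).2.2, isSmoothSubmanifold_singularStratum _⟩, ?_, ?_, ?_, ?_⟩
  · intro i j hij
    rw [Set.disjoint_left]
    intro A hi hj
    exact hij (e.symm.injective (Subtype.ext (hi.symm.trans hj)))
  · ext A
    rw [Set.mem_iUnion]
    constructor
    · rintro ⟨i, hi⟩
      have h := (e.symm i).2.1
      rw [← mem_singularStratum.1 hi] at h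
      exact h
    · intro hA
      exact ⟨e ⟨_, hA, A, rfl⟩, by simp [mem_singularStratum]⟩
  · intro i
    refine Nat.le_of_add_le_add_right (b := 2) ?_
    rw [heq]
    exact hle _ (e.symm i).2.1 (e.symm i).2.2
  · exact ⟨e ⟨_, hQ, singularStratum_coincidencePattern_nonempty hσ h0⟩,
      congrArg (fun q : I => Module.finrank ℝ (patternSpace q.1)) (e.symm_apply_apply _)⟩

end Strata

theorem theorem2p1 (n : ℕ) :
    Module.finrank ℝ (symmMatrices n) = n ^ 2 + n ∧
    (2 ≤ n → HasRealCodim (equalSingularValueSet n) 2) ∧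
    (1 ≤ n → HasRealCodim (zeroSingularValueSet n) 2) := by
  refine ⟨finrank_symmMatrices n, fun hn => ?_, fun hn => ?_⟩
  · -- `σ = (n, n, n - 1, …, 2)` has a single coincidence and no zero
    have hle : ∀ i : Fin n, ((max i.1 1 : ℕ) : ℝ) ≤ n := fun i =>
      Nat.cast_le.2 (max_le i.2.le (by omega))
    refine hasRealCodim_two_of_pattern (fun p => ∃ i j, i ≠ j ∧ p.1 i j)
      (fun p ⟨i, j, hij, hp⟩ _ => finrank_patternSpace_add_two_le_of_eq hij hp)
      (σ := fun i => (n : ℝ) + 1 - (max i.1 1 : ℕ)) ?_ (fun i => by linarith [hle i])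
      ⟨⟨0, by omega⟩, ⟨1, by omega⟩, by simp, by simp [coincidencePattern]⟩
      (finrank_patternSpace_of_single_pair (a := ⟨0, by omega⟩) (b := ⟨1, by omega⟩) (by simp)
        (fun i => by linarith [hle i]) (by simp) ?_)
    · intro i j hij
      have : max i.1 1 ≤ max j.1 1 := max_le_max_right 1 hij
      have : ((max i.1 1 : ℕ) : ℝ) ≤ (max j.1 1 : ℕ) := Nat.cast_le.2 this
      simp only
      linarith
    · intro i j hij
      have : max i.1 1 = max j.1 1 := by
        have : ((max i.1 1 : ℕ) : ℝ) = (max j.1 1 : ℕ) := by linarith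
        exact_mod_cast this
      simp only [Fin.ext_iff]
      omega
  · -- `σ = (n - 1, …, 1, 0)` has a single zero and no coincidence
    refine hasRealCodim_two_of_pattern (fun p => ∃ i, p.2 i)
      ?_ (σ := fun i => (n : ℝ) - 1 - i.1) ?_ ?_ ⟨⟨n - 1, by omega⟩, ?_⟩
      (finrank_patternSpace_of_single_zero (a := ⟨n - 1, by omega⟩) ?_ ?_)
    · rintro p ⟨i, hp⟩ ⟨A, rfl⟩
      exact finrank_patternSpace_add_two_le_of_zero (a := i) rfl hp
    · intro i j hij
      have : (i.1 : ℝ) ≤ j.1 := Nat.cast_le.2 hij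
      simp only
      linarith
    · intro i
      have : (i.1 : ℝ) + 1 ≤ n := by exact_mod_cast i.2
      linarith
    · simp [coincidencePattern, Nat.cast_sub hn]
    · intro i j hij
      simpa [Fin.ext_iff] using hij
    · simp [Nat.cast_sub hn]
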